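/- Let $K$ be a field and $n\ge 2$. Let $E=\{u_{j,i},u_{j,i}^*\}_{i,j=1}^n$ be a set of $2n^2$ distinct letters with the involution $*$ exchanging $u_{j,i}$ and $u_{j,i}^*$, and let $\varepsilon(i)=n-i+1$. For an $n\times n$ matrix $v$ with entries in $E$ define $v^{T}$, $\bar v$ and $v^{\ddagger}$ by $(v^T)_{j,i}=v_{i,j}$, $\bar v_{j,i}=v_{\varepsilon(j),\varepsilon(i)}^{*}$ and $v^{\ddagger}_{j,i}=v_{\varepsilon(i),\varepsilon(j)}^{*}$. Let $u=(u_{j,i})$ and $V=\{u,u^T,\bar u,u^{\ddagger}\}$. In the free unital algebra $K\langle E\rangle$ put, for $v\in V$ and $1\le i,j\le n$, $$r^v_{j,i}=\sum_{s=1}^n v_{j,\varepsilon(s)}v^{\ddagger}_{s,\varepsilon(i)}-\delta_{j,i}1,\qquad r^v=v_{n,n}v^{\ddagger}_{1,1}-\Big(\sum_{s=2}^{n}\sum_{t=1}^{n-1}v_{t,\varepsilon(s)}v^{\ddagger}_{s,\varepsilon(t)}-(n-2)1\Big).$$ Let $R=\{r^v_{j,i} : v\in V,\ 1\le i,j\le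 n\}$, let $I$ be the two-sided ideal generated by $R$, and let $G=\{r^v : v\in V\}\cup\{r^v_{j,i} : v\in V,\ (j,i)\ne(n,n)\}$. Order $E$ totally by letting every $u_{t,s}^*$ be less than every $u_{j,i}$, letting $u_{t,s}<u_{j,i}$ iff $(t,s)<(j,i)$ lexicographically, and letting $u_{t,s}^*<u_{j,i}^*$ iff $(j,i)<(t,s)$ lexicographically. Extend this order to the monomials (the words in $E$) degreewise lexicographically: first compare lengths, then compare words of equal length lexicographically from the left. The tip of a nonzero polynomial is the greatest monomial occurring in it. A Gröbner basis of $I$ is a subset of $I$ whose tips generate the set of tips of nonzero elements of $I$ as a monoidal ideal. It is minimal if it does not contain $0$ and no tip of an element divides the tip of a different element; a minimal one is reduced if moreover every tip has coefficient $1$ in its element and no tip of an element divides a monomial occurring in a different element. Then the order is a monomial order (a well-order strictly compatible with left and right multiplication), and: 1. $R$ is a Gröbner basis of $I$; it is not minimal; and the tip of $r^v_{j,i}$ is $v_{j,n}v^{\ddagger}_{1,\varepsilon(i)}$ for all $v\in V$ and $1\le i,j\le n$. 2. $G$ is a reduced Gröbner basis of $I$, and it is the only one. The tip of $r^v$ is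 $v_{n,n}v^{\ddagger}_{1,1}$ for all $v\in V$, and the set of tips of $G$ is $\{v_{j,n}v^{\ddagger}_{1,\varepsilon(i)} : v\in V,\ 1\le i,j\le n\}$. -/

import Mathlib

namespace UnitaryGB

/-! ### Tips and Gröbner bases in free algebras

Orders on the free monoid are given by their strict part `r` (`r b b'` reads `b < b'`). -/

section Groebner

variable {K : Type*} [Field K] {X : Type*}

/-- The coefficient of the monomial `b` in the noncommutative polynomial `p`. -/
noncomputable def coeff (p : FreeAlgebra K X) (b : FreeMonoid X) : K :=
  (FreeAlgebra.basisFreeMonoid K X).repr p b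

/-- `b` divides `b'`: there are `b₁`, `b₂` with `b₁ * b * b₂ = b'`. -/
def Divides (b b' : FreeMonoid X) : Prop :=
  ∃ b₁ b₂ : FreeMonoid X, b₁ * b * b₂ = b'

/-- The monoidal ideal of the free monoid generated by `S`: all multiples of elements of `S`. -/
def monoidalSpan (S : Set (FreeMonoid X)) : Set (FreeMonoid X) :=
  {b' | ∃ b ∈ S, Divides b b'}

/-- A monomial order: a well-order on the free monoid that is strictly compatible with
multiplication from the left and from the right. -/
structure IsMonomialOrder (r : FreeMonoid X → FreeMonoid X → Prop) : Prop where
  isWellOrder : IsWellOrder (FreeMonoid X) r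
  mul_left : ∀ c b b' : FreeMonoid X, r b b' → r (c * b) (c * b')
  mul_right : ∀ c b b' : FreeMonoid X, r b b' → r (b * c) (b' * c)

/-- `b` is the tip of `p`: the greatest of the monomials that occur in `p`.
(The zero polynomial has no tip.) -/
def IsTip (r : FreeMonoid X → FreeMonoid X → Prop) (p : FreeAlgebra K X) (b : FreeMonoid X) :
    Prop :=
  coeff p b ≠ 0 ∧ ∀ b', coeff p b' ≠ 0 → b' = b ∨ r b' b

/-- The set of the tips of all nonzero elements of `J`. -/
def tips (r : FreeMonoid X → FreeMonoid X → Prop) (J : Set (FreeAlgebra K X)) :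
    Set (FreeMonoid X) :=
  {b | ∃ p ∈ J, IsTip r p b}

/-- `G` is a Gröbner basis of the two-sided ideal `I`: it is a subset of `I`, and its tips
generate the tips of `I` as a monoidal ideal. -/
def IsGroebnerBasis (r : FreeMonoid X → FreeMonoid X → Prop)
    (I : TwoSidedIdeal (FreeAlgebra K X)) (G : Set (FreeAlgebra K X)) : Prop :=
  G ⊆ {p | p ∈ I} ∧ monoidalSpan (tips r G) = tips r {p | p ∈ I}

/-- A minimal Gröbner basis: `0` is not in `G`, and no tip of an element of `G` divides the tip
of a different element of `G`. -/
def IsMinimalGroebnerBasis (r : FreeMonoid X → FreeMonoid X → Prop)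
    (I : TwoSidedIdeal (FreeAlgebra K X)) (G : Set (FreeAlgebra K X)) : Prop :=
  IsGroebnerBasis r I G ∧ 0 ∉ G ∧
    ∀ g ∈ G, ∀ g' ∈ G, g ≠ g' → ∀ b b', IsTip r g b → IsTip r g' b' → ¬ Divides b b'

/-- A reduced Gröbner basis: a minimal one whose elements have leading coefficient `1`, and such
that no tip of an element of `G` divides a monomial occurring in a different element of `G`. -/
def IsReducedGroebnerBasis (r : FreeMonoid X → FreeMonoid X → Prop)
    (I : TwoSidedIdeal (FreeAlgebra K X)) (G : Set (FreeAlgebra K X)) : Prop :=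
  IsMinimalGroebnerBasis r I G ∧
    (∀ g ∈ G, ∀ b, IsTip r g b → coeff g b = 1) ∧
    ∀ g ∈ G, ∀ g' ∈ G, g ≠ g' → ∀ b c, IsTip r g b → coeff g' c ≠ 0 → ¬ Divides b c

end Groebner

/-! ### Generators of the free unitary quantum group and their order -/

/-- The `2n²` generators: `u j i` is the matrix entry `u_{j,i}` and `ustar j i` is its adjoint
`u_{j,i}^*`. Indices run over `Fin n`, so `0` stands for the index `1` and `Fin.rev` for the
reflection `i ↦ n - i + 1`. -/
inductive Gen (n : ℕ) : Type
  | u (j i : Fin n) : Gen n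
  | ustar (j i : Fin n) : Gen n

/-- The involution `*` on the generators. -/
def Gen.adj {n : ℕ} : Gen n → Gen n
  | .u j i => .ustar j i
  | .ustar j i => .u j i

/-- The strict order on the generators: every `u_{t,s}^*` is less than every `u_{j,i}`, the
`u_{j,i}` are ordered lexicographically by `(j,i)`, and the `u_{j,i}^*` oppositely. -/
def Gen.lt {n : ℕ} : Gen n → Gen n → Prop
  | .ustar _ _, .u _ _ => True
  | .u _ _, .ustar _ _ => False
  | .ustar t s, .ustar j i => Prod.Lex (· < ·) (· < ·) (j, i) (t, s)
  | .u t s, .u j i => Prod.Lex (· < ·) (· < ·) (t, s) (j, i)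

/-- The degreewise lexicographic extension of the order on the generators to all monomials. -/
def monLT (n : ℕ) (a b : FreeMonoid (Gen n)) : Prop :=
  List.Shortlex Gen.lt (FreeMonoid.toList a) (FreeMonoid.toList b)

/-! ### The four matrices, the relations and the modified elements -/

/-- The matrix `u`. -/
def matU (n : ℕ) : Matrix (Fin n) (Fin n) (Gen n) := fun j i => Gen.u j i

/-- The matrix with `(j,i)` entry `v_{ε(j),ε(i)}^*`. -/
def skewStar {n : ℕ} (v : Matrix (Fin n) (Fin n) (Gen n)) : Matrix (Fin n) (Fin n) (Gen n) :=
  fun j i => (v j.rev i.rev).adj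

/-- The matrix `v^‡` with `(j,i)` entry `v_{ε(i),ε(j)}^*`. -/
def skewDagger {n : ℕ} (v : Matrix (Fin n) (Fin n) (Gen n)) : Matrix (Fin n) (Fin n) (Gen n) :=
  fun j i => (v i.rev j.rev).adj

/-- The set of the four matrices: `u`, its transpose, and their skew counterparts. -/
def matrices (n : ℕ) : Set (Matrix (Fin n) (Fin n) (Gen n)) :=
  {matU n, (matU n).transpose, skewStar (matU n), skewDagger (matU n)}

variable (K : Type*) [Field K] {n : ℕ}

/-- A generator as an element of the free algebra. -/
def gen (e : Gen n) : FreeAlgebra K (Gen n) := FreeAlgebra.ι K e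

/-- The relation `r^v_{j,i} = ∑ s, v_{j,ε(s)} v^‡_{s,ε(i)} - δ_{j,i} 1`. -/
noncomputable def rel (v : Matrix (Fin n) (Fin n) (Gen n)) (j i : Fin n) :
    FreeAlgebra K (Gen n) :=
  (∑ s : Fin n, gen K (v j s.rev) * gen K (skewDagger v s i.rev)) - (if j = i then 1 else 0)

variable (n) in
/-- The set `R` of defining relations. -/
def rels : Set (FreeAlgebra K (Gen n)) :=
  {p | ∃ v ∈ matrices n, ∃ j i : Fin n, p = rel K v j i}

variable (n) in
/-- The two-sided ideal `I` generated by the relations. -/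
noncomputable def relIdeal : TwoSidedIdeal (FreeAlgebra K (Gen n)) :=
  TwoSidedIdeal.span (rels K n)

variable (n) in
/-- The last index, called `n` in `1, …, n`. -/
def lastIdx [NeZero n] : Fin n := Fin.rev 0

/-- The modified element
`r^v = v_{n,n} v^‡_{1,1} - (∑_{s=2}^n ∑_{t=1}^{n-1} v_{t,ε(s)} v^‡_{s,ε(t)} - (n-2) 1)`. -/
noncomputable def modRel [NeZero n] (v : Matrix (Fin n) (Fin n) (Gen n)) :
    FreeAlgebra K (Gen n) :=
  gen K (v (lastIdx n) (lastIdx n)) * gen K (skewDagger v 0 0) -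
    ((∑ s ∈ Finset.univ.filter (fun s : Fin n => s ≠ 0),
        ∑ t ∈ Finset.univ.filter (fun t : Fin n => t ≠ lastIdx n),
          gen K (v t s.rev) * gen K (skewDagger v s t.rev)) -
      algebraMap K (FreeAlgebra K (Gen n)) ((n : K) - 2))

variable (n) in
/-- The set `G`: in `R`, the elements `r^v_{n,n}` are replaced by the modified elements `r^v`. -/
def redBasis [NeZero n] : Set (FreeAlgebra K (Gen n)) :=
  {p | ∃ v ∈ matrices n, p = modRel K v ∨
    ∃ j i : Fin n, (j, i) ≠ (lastIdx n, lastIdx n) ∧ p = rel K v j i}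

/-- The monomial `v_{j,n} v^‡_{1,ε(i)}`. -/
def tipWord [NeZero n] (v : Matrix (Fin n) (Fin n) (Gen n)) (j i : Fin n) : FreeMonoid (Gen n) :=
  FreeMonoid.of (v j (lastIdx n)) * FreeMonoid.of (skewDagger v 0 i.rev)

end UnitaryGB

open UnitaryGB

/-!
# The reduced Gröbner basis of the free unitary quantum group

Write `l` for the last index. Up to reindexing by `Fin.rev`, the relation `r^v_{j,i}` is the
`(j,i)` entry of `v v^* - 1`, where `v^*` is the conjugate transpose: it is the sum of the words
`v_{j,s} v_{i,s}^*` (`relWord v j i s`) minus `δ_{j,i}`. The entries of each of the four matrices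
increase along rows and down columns, so that its tip is the word with `s = l`.

That the relations form a Gröbner basis follows from Buchberger's criterion in the form
`isGroebnerBasis_of_syzygiesResolve`: if any two monomial multiples of relations with the same tip
are congruent modulo multiples with smaller tip, then every nonzero element of the ideal is, up to a
nonzero scalar, one such multiple plus multiples with smaller tip, and therefore inherits its tip.
All tips are words of length two, and then only equal tips and one-letter overlaps matter
(`syzygiesResolve_of_quadratic`). No reductions have to be carried out for them, since each case is
one matrix identity whose remaining terms all have smaller tips:

* The only overlaps are `v_{j,l} v_{0,l}^* v_{0,k}` (`overlap_cases`). The identity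
  `(v v^* - 1) v = v (v^* v - 1)` resolves them (`overlap_mem`); the entries of `v^* v - 1` are the
  relations of `v^‡`.
* The only coinciding tips are those of `r^v_{l,l}` and `r^{v^T}_{l,l}` (`relWord_lastIdx_congr`).
  The relations of `v` and of `v^T` have the same trace, and this resolves them
  (`rel_sub_rel_transpose_mem`). The two elements differ, so the set of relations is not minimal.

The modified element is `r^v = r^v_{l,l} - ∑_{s ≠ l} r^{v^T}_{s,s}`, so it belongs to the ideal; it
has the tip of `r^v_{l,l}`, and it is the same for `v` and `v^T`. Hence the modified set has the same
tips as the relations, each belonging to exactly one element. A word `v_{j,s} v_{i,s}^*` with `s ≠ l`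
is a tip only if `j = i = l` (`relWord_eq_relWord_lastIdx`), and no such word is left in the modified
set, which is therefore reduced. Uniqueness holds for reduced Gröbner bases with respect to any
monomial order (`IsReducedGroebnerBasis.subset`).
-/

namespace UnitaryGB

/-! ### Monomials and supports -/

section General

variable {K : Type*} [Field K] {X : Type*}

variable (K) in
/-- The monomials of the free algebra, as a monoid homomorphism from the free monoid. -/
noncomputable def mon : FreeMonoid X →* FreeAlgebra K X :=
  FreeMonoid.lift (FreeAlgebra.ι K)

theorem basisFreeMonoid_apply (b : FreeMonoid X) :
    FreeAlgebra.basisFreeMonoid K X b = mon K b := by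
  simp [FreeAlgebra.basisFreeMonoid, mon, FreeAlgebra.equivMonoidAlgebraFreeMonoid]

theorem coeff_mon_self (b : FreeMonoid X) : coeff (mon K b) b = 1 := by
  simp [coeff, ← basisFreeMonoid_apply]

theorem coeff_mon_of_ne {b c : FreeMonoid X} (h : b ≠ c) : coeff (mon K b) c = 0 := by
  simp [coeff, ← basisFreeMonoid_apply, h]

@[simp] theorem coeff_zero (b : FreeMonoid X) : coeff (0 : FreeAlgebra K X) b = 0 := by
  simp [coeff]

@[simp] theorem coeff_add (p q : FreeAlgebra K X) (b : FreeMonoid X) :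
    coeff (p + q) b = coeff p b + coeff q b := by
  simp [coeff]

@[simp] theorem coeff_sub (p q : FreeAlgebra K X) (b : FreeMonoid X) :
    coeff (p - q) b = coeff p b - coeff q b := by
  simp [coeff]

@[simp] theorem coeff_smul (c : K) (p : FreeAlgebra K X) (b : FreeMonoid X) :
    coeff (c • p) b = c * coeff p b := by
  simp [coeff]

variable (K) in
/-- The polynomials all of whose monomials lie in `S`. -/
def supportedIn (S : Set (FreeMonoid X)) : Submodule K (FreeAlgebra K X) where
  carrier := {p | ∀ b, coeff p b ≠ 0 → b ∈ S}
  add_mem' {p q} hp hq b hb := by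
    by_cases h : coeff p b = 0
    · exact hq b fun h' => hb (by simp [h, h'])
    · exact hp b h
  zero_mem' b hb := (hb (coeff_zero b)).elim
  smul_mem' c p hp b hb := hp b fun h => hb (by simp [h])

theorem supportedIn_mono {S T : Set (FreeMonoid X)} (h : S ⊆ T) :
    supportedIn K S ≤ supportedIn K T := fun _ hp b hb => h (hp b hb)

theorem mon_mem_supportedIn {S : Set (FreeMonoid X)} {b : FreeMonoid X} (hb : b ∈ S) :
    mon K b ∈ supportedIn K S := by
  intro c hc
  by_contra h
  exact hc (coeff_mon_of_ne fun e => h (e ▸ hb))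

theorem supportedIn_eq_span (S : Set (FreeMonoid X)) :
    supportedIn K S = Submodule.span K (mon K '' S) := by
  refine le_antisymm (fun p hp => ?_) ?_
  · rw [← (FreeAlgebra.basisFreeMonoid K X).linearCombination_repr p,
      Finsupp.linearCombination_apply]
    refine Submodule.sum_mem _ fun b hb => Submodule.smul_mem _ _ (Submodule.subset_span ?_)
    exact ⟨b, hp b (Finsupp.mem_support_iff.1 hb), (basisFreeMonoid_apply b).symm⟩
  · rw [Submodule.span_le]
    rintro _ ⟨b, hb, rfl⟩
    exact mon_mem_supportedIn hb

/-- A linear map sends a polynomial supported in `S` into `N` as soon as it does so for the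
monomials in `S`. -/
theorem map_mem_of_supportedIn {M : Type*} [AddCommGroup M] [Module K M]
    {S : Set (FreeMonoid X)} {p : FreeAlgebra K X} (hp : p ∈ supportedIn K S)
    (φ : FreeAlgebra K X →ₗ[K] M) (N : Submodule K M) (h : ∀ b ∈ S, φ (mon K b) ∈ N) :
    φ p ∈ N := by
  rw [supportedIn_eq_span] at hp
  have : Submodule.span K (mon K '' S) ≤ N.comap φ := by
    rw [Submodule.span_le]
    rintro _ ⟨b, hb, rfl⟩
    exact h b hb
  exact this hp

/-! ### Tips -/

variable {r : FreeMonoid X → FreeMonoid X → Prop}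

theorem IsMonomialOrder.irrefl (hr : IsMonomialOrder r) (b : FreeMonoid X) : ¬ r b b := by
  have := hr.isWellOrder
  exact irrefl_of r b

theorem IsMonomialOrder.trans (hr : IsMonomialOrder r) {a b c : FreeMonoid X} (h : r a b)
    (h' : r b c) : r a c := by
  have := hr.isWellOrder
  exact trans_of r h h'

theorem IsMonomialOrder.trichotomy (hr : IsMonomialOrder r) (a b : FreeMonoid X) :
    r a b ∨ a = b ∨ r b a := by
  have := hr.isWellOrder
  exact trichotomous_of r a b

theorem IsMonomialOrder.wellFounded (hr : IsMonomialOrder r) : WellFounded r := by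
  have := hr.isWellOrder
  exact IsWellFounded.wf

theorem IsMonomialOrder.mul_mul (hr : IsMonomialOrder r) {b b' : FreeMonoid X} (a c : FreeMonoid X)
    (h : r b b') : r (a * b * c) (a * b' * c) :=
  hr.mul_right _ _ _ (hr.mul_left _ _ _ h)

/-- In a monomial order `1` is the least monomial: otherwise `b < 1` would give the infinite
descent `1 > b > b² > ⋯`. -/
theorem IsMonomialOrder.one_min (hr : IsMonomialOrder r) (b : FreeMonoid X) : ¬ r b 1 := by
  intro h
  refine hr.wellFounded.induction (C := fun x => (∃ k, x = b ^ k) → False) 1 ?_ ⟨0, by simp⟩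
  rintro x ih ⟨k, rfl⟩
  exact ih (b ^ (k + 1)) (by simpa [pow_succ] using hr.mul_left (b ^ k) _ _ h) ⟨k + 1, rfl⟩

theorem IsMonomialOrder.not_lt_of_divides (hr : IsMonomialOrder r) {b b' : FreeMonoid X}
    (h : Divides b b') : ¬ r b' b := by
  obtain ⟨x, y, rfl⟩ := h
  intro h
  have h1 : b = x * b ∨ r b (x * b) := by
    rcases hr.trichotomy 1 x with hx | rfl | hx
    · exact .inr (by simpa using hr.mul_right b _ _ hx)
    · simp
    · exact (hr.one_min _ hx).elim
  have h2 : x * b = x * b * y ∨ r (x * b) (x * b * y) := by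
    rcases hr.trichotomy 1 y with hx | rfl | hx
    · exact .inr (by simpa using hr.mul_left (x * b) _ _ hx)
    · simp
    · exact (hr.one_min _ hx).elim
  rcases h1 with h1 | h1 <;> rcases h2 with h2 | h2
  · exact hr.irrefl b (by rwa [← h2, ← h1] at h)
  · exact hr.irrefl b (by rw [← h1] at h2 h; exact hr.trans h2 h)
  · exact hr.irrefl b (by rw [← h2] at h; exact hr.trans h1 h)
  · exact hr.irrefl b (hr.trans (hr.trans h1 h2) h)

theorem Divides.trans {a b c : FreeMonoid X} (h : Divides a b) (h' : Divides b c) :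
    Divides a c := by
  obtain ⟨x, y, rfl⟩ := h
  obtain ⟨z, w, rfl⟩ := h'
  exact ⟨z * x, y * w, by simp only [mul_assoc]⟩

theorem Divides.eq_of_length_le {a b : FreeMonoid X} (h : Divides a b)
    (hl : b.length ≤ a.length) : a = b := by
  obtain ⟨x, y, rfl⟩ := h
  simp only [FreeMonoid.length_mul] at hl
  rw [FreeMonoid.length_eq_zero.1 (by omega : x.length = 0),
    FreeMonoid.length_eq_zero.1 (by omega : y.length = 0)]
  simp

theorem Divides.antisymm {a b : FreeMonoid X} (h : Divides a b) (h' : Divides b a) : a = b := by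
  refine h.eq_of_length_le ?_
  obtain ⟨x, y, rfl⟩ := h'
  simp only [FreeMonoid.length_mul]
  omega

theorem IsTip.unique (hr : IsMonomialOrder r) {p : FreeAlgebra K X} {b b' : FreeMonoid X}
    (h : IsTip r p b) (h' : IsTip r p b') : b = b' := by
  rcases h.2 _ h'.1 with e | e
  · exact e.symm
  rcases h'.2 _ h.1 with e' | e'
  · exact e'
  · exact (hr.irrefl _ (hr.trans e e')).elim

theorem IsTip.ne_zero {p : FreeAlgebra K X} {b : FreeMonoid X} (h : IsTip r p b) : p ≠ 0 := by
  rintro rfl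
  exact h.1 (coeff_zero b)

theorem exists_coeff_ne_zero {p : FreeAlgebra K X} (hp : p ≠ 0) : ∃ b, coeff p b ≠ 0 := by
  by_contra! h
  exact hp ((FreeAlgebra.basisFreeMonoid K X).repr.map_eq_zero_iff.1 (Finsupp.ext h))

theorem exists_isTip (hr : IsMonomialOrder r) {p : FreeAlgebra K X} (hp : p ≠ 0) :
    ∃ b, IsTip r p b := by
  have := hr.isWellOrder
  let := IsWellOrder.linearOrder r
  obtain ⟨b, hb⟩ := exists_coeff_ne_zero hp
  obtain ⟨m, hm, hmax⟩ := Finset.exists_max_image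
    ((FreeAlgebra.basisFreeMonoid K X).repr p).support id ⟨b, Finsupp.mem_support_iff.2 hb⟩
  refine ⟨m, Finsupp.mem_support_iff.1 hm, fun c hc => ?_⟩
  exact (hmax c (Finsupp.mem_support_iff.2 hc)).eq_or_lt

theorem isTip_of_sub_mem (hr : IsMonomialOrder r) {p : FreeAlgebra K X} {w : FreeMonoid X} {c : K}
    (hc : c ≠ 0) (h : p - c • mon K w ∈ supportedIn K {b | r b w}) :
    IsTip r p w ∧ coeff p w = c := by
  have h1 : coeff p w = c := by
    by_contra hne
    refine hr.irrefl w (h w ?_)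
    simpa [coeff_mon_self, sub_eq_zero] using hne
  refine ⟨⟨h1 ▸ hc, fun b hb => ?_⟩, h1⟩
  by_cases e : b = w
  · exact .inl e
  · exact .inr (h b (by simpa [coeff_mon_of_ne (Ne.symm e)] using hb))

/-- Multiplying by monomials from both sides shifts the bound on the support. -/
theorem mon_mul_mul_mon_mem_supportedIn (hr : IsMonomialOrder r) {p : FreeAlgebra K X}
    {w : FreeMonoid X} (hp : p ∈ supportedIn K {b | r b w}) (a c : FreeMonoid X) :
    mon K a * p * mon K c ∈ supportedIn K {b | r b (a * w * c)} := by
  refine map_mem_of_supportedIn hp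
    (LinearMap.mulRight K (mon K c) ∘ₗ LinearMap.mulLeft K (mon K a)) _ fun b hb => ?_
  simp only [LinearMap.comp_apply, LinearMap.mulLeft_apply, LinearMap.mulRight_apply, ← map_mul]
  exact mon_mem_supportedIn (hr.mul_mul a c hb)

/-! ### A criterion for Gröbner bases -/

variable {ι : Type*}

/-- The span of the two-sided monomial multiples `a * f i * b` for which the monomial
`a * t i * b` lies in `S`. Here `t i` is to be thought of as the tip of `f i`. -/
def multiplesIn (f : ι → FreeAlgebra K X) (t : ι → FreeMonoid X) (S : Set (FreeMonoid X)) :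
    Submodule K (FreeAlgebra K X) :=
  Submodule.span K {p | ∃ a i b, a * t i * b ∈ S ∧ p = mon K a * f i * mon K b}

variable {f : ι → FreeAlgebra K X} {t : ι → FreeMonoid X}

theorem mem_multiplesIn {S : Set (FreeMonoid X)} (a : FreeMonoid X) (i : ι) (b : FreeMonoid X)
    (h : a * t i * b ∈ S) : mon K a * f i * mon K b ∈ multiplesIn f t S :=
  Submodule.subset_span ⟨a, i, b, h, rfl⟩

theorem multiplesIn_mono {S T : Set (FreeMonoid X)} (h : S ⊆ T) :
    multiplesIn f t S ≤ multiplesIn f t T := by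
  refine Submodule.span_mono ?_
  rintro _ ⟨a, i, b, hS, rfl⟩
  exact ⟨a, i, b, h hS, rfl⟩

theorem mon_mul_mul_mon_mem_multiplesIn (hr : IsMonomialOrder r) {p : FreeAlgebra K X}
    {w : FreeMonoid X} (hp : p ∈ multiplesIn f t {b | r b w}) (a c : FreeMonoid X) :
    mon K a * p * mon K c ∈ multiplesIn f t {b | r b (a * w * c)} := by
  have : multiplesIn f t {b | r b w} ≤ (multiplesIn f t {b | r b (a * w * c)}).comap
      (LinearMap.mulRight K (mon K c) ∘ₗ LinearMap.mulLeft K (mon K a)) := by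
    refine Submodule.span_le.2 ?_
    rintro _ ⟨x, i, y, h, rfl⟩
    have := mem_multiplesIn (f := f) (t := t) (S := {b | r b (a * w * c)}) (a * x) i (y * c)
      (by simpa only [mul_assoc, Set.mem_ofPred_eq] using hr.mul_mul a c h)
    simpa [map_mul, mul_assoc] using this
  exact this hp

theorem mon_mul_mul_mon_sub_mem (hr : IsMonomialOrder r)
    (ht : ∀ i, f i - mon K (t i) ∈ supportedIn K {b | r b (t i)})
    (a : FreeMonoid X) (i : ι) (b : FreeMonoid X) :
    mon K a * f i * mon K b - mon K (a * t i * b) ∈ supportedIn K {c | r c (a * t i * b)} := by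
  have := mon_mul_mul_mon_mem_supportedIn hr (ht i) a b
  simpa [mul_sub, sub_mul, mul_assoc] using this

theorem multiplesIn_le_supportedIn (hr : IsMonomialOrder r)
    (ht : ∀ i, f i - mon K (t i) ∈ supportedIn K {b | r b (t i)}) (w : FreeMonoid X) :
    multiplesIn f t {b | r b w} ≤ supportedIn K {b | r b w} := by
  refine Submodule.span_le.2 ?_
  rintro _ ⟨a, i, b, h, rfl⟩
  have h1 := supportedIn_mono (K := K) (T := {b | r b w}) (fun c hc => hr.trans hc h)
    (mon_mul_mul_mon_sub_mem hr ht a i b)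
  simpa using add_mem h1 (mon_mem_supportedIn (K := K) (S := {b | r b w}) h)

/-- Any two multiples `a * f i * b` and `a' * f i' * b'` with the same tip
`a * t i * b = a' * t i' * b'` are congruent modulo multiples with smaller tip. -/
def SyzygiesResolve (r : FreeMonoid X → FreeMonoid X → Prop) (f : ι → FreeAlgebra K X)
    (t : ι → FreeMonoid X) : Prop :=
  ∀ a i b a' i' b', a * t i * b = a' * t i' * b' →
    mon K a * f i * mon K b - mon K a' * f i' * mon K b' ∈ multiplesIn f t {c | r c (a * t i * b)}

/-- If the syzygies resolve, a nonzero element of `multiplesIn f t S` is, up to a nonzero scalar, one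
multiple plus multiples with smaller tip. The hypothesis `ih` is this claim for the sets
`{b | r b w}`; it is needed when leading multiples cancel. -/
theorem eq_zero_or_exists_leading (hr : IsMonomialOrder r) (H : SyzygiesResolve r f t)
    (S : Set (FreeMonoid X)) (hS : ∀ w w', r w w' → w' ∈ S → w ∈ S)
    (ih : ∀ w ∈ S, ∀ p ∈ multiplesIn f t {b | r b w}, p = 0 ∨ ∃ a i b, ∃ c : K, c ≠ 0 ∧
      r (a * t i * b) w ∧
      p - c • (mon K a * f i * mon K b) ∈ multiplesIn f t {x | r x (a * t i * b)})
    (p : FreeAlgebra K X) (hp : p ∈ multiplesIn f t S) :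
    p = 0 ∨ ∃ a i b, ∃ c : K, c ≠ 0 ∧ a * t i * b ∈ S ∧
      p - c • (mon K a * f i * mon K b) ∈ multiplesIn f t {x | r x (a * t i * b)} := by
  -- If the leading multiple of `q` has the greater tip, it is also the leading multiple of `p + q`.
  have aux : ∀ (p q : FreeAlgebra K X) (a i b) (c : K) (a' i' b') (c' : K), c' ≠ 0 →
      a' * t i' * b' ∈ S →
      p - c • (mon K a * f i * mon K b) ∈ multiplesIn f t {x | r x (a * t i * b)} →
      q - c' • (mon K a' * f i' * mon K b') ∈ multiplesIn f t {x | r x (a' * t i' * b')} →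
      r (a * t i * b) (a' * t i' * b') →
      ∃ a i b, ∃ c : K, c ≠ 0 ∧ a * t i * b ∈ S ∧
        p + q - c • (mon K a * f i * mon K b) ∈ multiplesIn f t {x | r x (a * t i * b)} := by
    intro p q a i b c a' i' b' c' hc' hS' h h' hlt
    refine ⟨a', i', b', c', hc', hS', ?_⟩
    have h1 : p ∈ multiplesIn f t {x | r x (a' * t i' * b')} := by
      have := add_mem (multiplesIn_mono (T := {x | r x (a' * t i' * b')})
        (fun x hx => hr.trans hx hlt) h)
        (Submodule.smul_mem _ c (mem_multiplesIn (f := f) (t := t) a i b hlt))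
      simpa using this
    simpa [add_sub_assoc] using add_mem h1 h'
  induction hp using Submodule.span_induction with
  | mem x hx =>
    obtain ⟨a, i, b, h, rfl⟩ := hx
    exact .inr ⟨a, i, b, 1, one_ne_zero, h, by simp⟩
  | zero => exact .inl rfl
  | smul c x _ hx =>
    rcases hx with rfl | ⟨a, i, b, d, hd, h, hx⟩
    · simp
    · by_cases hc : c = 0
      · simp [hc]
      · refine .inr ⟨a, i, b, c * d, mul_ne_zero hc hd, h, ?_⟩
        rw [mul_smul, ← smul_sub]
        exact Submodule.smul_mem _ _ hx
  | add x y _ _ hx hy =>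
    rcases hx with rfl | ⟨a, i, b, c, hc, h, hx⟩
    · simpa using hy
    rcases hy with rfl | ⟨a', i', b', c', hc', h', hy⟩
    · exact .inr ⟨a, i, b, c, hc, h, by simpa using hx⟩
    rcases hr.trichotomy (a * t i * b) (a' * t i' * b') with hlt | heq | hlt
    · exact .inr (aux _ _ _ _ _ _ _ _ _ _ hc' h' hx hy hlt)
    · have hz : x + y - (c + c') • (mon K a * f i * mon K b) ∈
          multiplesIn f t {x | r x (a * t i * b)} := by
        have h1 := Submodule.smul_mem _ c' (H a i b a' i' b' heq)
        rw [← heq] at hy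
        have := sub_mem (add_mem hx hy) h1
        convert this using 1
        rw [add_smul, smul_sub]
        abel
      by_cases h0 : c + c' = 0
      · rw [h0, zero_smul, sub_zero] at hz
        rcases ih _ h _ hz with e | ⟨a₁, i₁, b₁, c₁, hc₁, hlt, h₁⟩
        · exact .inl e
        · exact .inr ⟨a₁, i₁, b₁, c₁, hc₁, hS _ _ hlt h, h₁⟩
      · exact .inr ⟨a, i, b, c + c', h0, h, hz⟩
    · rw [add_comm]
      exact .inr (aux _ _ _ _ _ _ _ _ _ _ hc h hy hx hlt)

theorem exists_leading (hr : IsMonomialOrder r) (H : SyzygiesResolve r f t)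
    {p : FreeAlgebra K X} (hp : p ∈ multiplesIn f t Set.univ) (h0 : p ≠ 0) :
    ∃ a i b, ∃ c : K, c ≠ 0 ∧
      p - c • (mon K a * f i * mon K b) ∈ multiplesIn f t {x | r x (a * t i * b)} := by
  have key : ∀ w, ∀ p ∈ multiplesIn f t {b | r b w}, p = 0 ∨ ∃ a i b, ∃ c : K, c ≠ 0 ∧
      r (a * t i * b) w ∧
      p - c • (mon K a * f i * mon K b) ∈ multiplesIn f t {x | r x (a * t i * b)} := fun w =>
    hr.wellFounded.induction w fun w ih => eq_zero_or_exists_leading hr H {b | r b w}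
      (fun _ _ h h' => hr.trans h h') ih
  obtain ⟨a, i, b, c, hc, -, h⟩ := (eq_zero_or_exists_leading hr H Set.univ
    (fun _ _ _ _ => trivial) (fun w _ => key w) p hp).resolve_left h0
  exact ⟨a, i, b, c, hc, h⟩

theorem mem_multiplesIn_univ_of_mem_span {p : FreeAlgebra K X}
    (hp : p ∈ TwoSidedIdeal.span (Set.range f)) : p ∈ multiplesIn f t Set.univ := by
  have huniv : ∀ q : FreeAlgebra K X, q ∈ supportedIn K Set.univ := fun q b _ => trivial
  induction hp using TwoSidedIdeal.span_induction with
  | mem x hx =>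
    obtain ⟨i, rfl⟩ := hx
    simpa using mem_multiplesIn (K := K) (f := f) (t := t) (S := Set.univ) 1 i 1 trivial
  | zero => exact zero_mem _
  | add x y _ _ hx hy => exact add_mem hx hy
  | neg x _ hx => exact neg_mem hx
  | left_absorb q x _ hx =>
    refine map_mem_of_supportedIn (huniv q) (LinearMap.mulRight K x) _ fun d _ => ?_
    have : multiplesIn f t Set.univ ≤
        (multiplesIn f t Set.univ).comap (LinearMap.mulLeft K (mon K d)) := by
      refine Submodule.span_le.2 ?_
      rintro _ ⟨a, i, b, -, rfl⟩
      have := mem_multiplesIn (K := K) (f := f) (t := t) (S := Set.univ) (d * a) i b trivial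
      simpa [mul_assoc] using this
    exact this hx
  | right_absorb q x _ hx =>
    refine map_mem_of_supportedIn (huniv q) (LinearMap.mulLeft K x) _ fun d _ => ?_
    have : multiplesIn f t Set.univ ≤
        (multiplesIn f t Set.univ).comap (LinearMap.mulRight K (mon K d)) := by
      refine Submodule.span_le.2 ?_
      rintro _ ⟨a, i, b, -, rfl⟩
      have := mem_multiplesIn (K := K) (f := f) (t := t) (S := Set.univ) a i (b * d) trivial
      simpa [mul_assoc] using this
    exact this hx

theorem IsTip.mon_mul_mul_mon (hr : IsMonomialOrder r) {p : FreeAlgebra K X} {w : FreeMonoid X}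
    (h : IsTip r p w) (a b : FreeMonoid X) : IsTip r (mon K a * p * mon K b) (a * w * b) := by
  have h1 : p - coeff p w • mon K w ∈ supportedIn K {b | r b w} := by
    intro c hc
    by_cases e : c = w
    · simp [e, coeff_mon_self] at hc
    · refine (h.2 c ?_).resolve_left e
      simpa [coeff_mon_of_ne (Ne.symm e)] using hc
  have h2 := mon_mul_mul_mon_mem_supportedIn hr h1 a b
  refine (isTip_of_sub_mem hr h.1 (c := coeff p w) ?_).1
  simpa [mul_sub, sub_mul, mul_assoc] using h2

/-- The tips of an ideal form a monoidal ideal, so they contain everything generated by tips of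
elements of the ideal. -/
theorem monoidalSpan_tips_subset (hr : IsMonomialOrder r) {I : TwoSidedIdeal (FreeAlgebra K X)}
    {G : Set (FreeAlgebra K X)} (hG : G ⊆ {p | p ∈ I}) :
    monoidalSpan (tips r G) ⊆ tips r {p | p ∈ I} := by
  rintro _ ⟨w, ⟨p, hp, hw⟩, a, b, rfl⟩
  exact ⟨mon K a * p * mon K b, I.mul_mem_right _ _ (I.mul_mem_left _ _ (hG hp)),
    hw.mon_mul_mul_mon hr a b⟩

theorem isGroebnerBasis_of_syzygiesResolve (hr : IsMonomialOrder r)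
    (ht : ∀ i, f i - mon K (t i) ∈ supportedIn K {b | r b (t i)}) (H : SyzygiesResolve r f t) :
    IsGroebnerBasis r (TwoSidedIdeal.span (Set.range f)) (Set.range f) := by
  refine ⟨TwoSidedIdeal.subset_span,
    (monoidalSpan_tips_subset hr TwoSidedIdeal.subset_span).antisymm ?_⟩
  rintro w ⟨p, hp, hw⟩
  obtain ⟨a, i, b, c, hc, h⟩ := exists_leading hr H
    (mem_multiplesIn_univ_of_mem_span (t := t) hp) hw.ne_zero
  have h1 : p - c • mon K (a * t i * b) ∈ supportedIn K {x | r x (a * t i * b)} := by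
    have := add_mem (multiplesIn_le_supportedIn hr ht _ h)
      (Submodule.smul_mem _ c (mon_mul_mul_mon_sub_mem hr ht a i b))
    simpa [smul_sub] using this
  rw [hw.unique hr (isTip_of_sub_mem hr hc h1).1]
  exact ⟨t i, ⟨f i, ⟨i, rfl⟩,
    (isTip_of_sub_mem hr one_ne_zero (by simpa using ht i)).1⟩, a, b, rfl⟩

/-- Two multiples whose tips occupy disjoint places in the same word always resolve. -/
theorem disjoint_syzygy_mem (hr : IsMonomialOrder r)
    (ht : ∀ i, f i - mon K (t i) ∈ supportedIn K {b | r b (t i)}) (c : FreeMonoid X) (i i' : ι) :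
    f i * mon K (c * t i') - mon K (t i * c) * f i' ∈
      multiplesIn f t {x | r x (t i * c * t i')} := by
  have h1 : f i * mon K c * (f i' - mon K (t i')) ∈
      multiplesIn f t {x | r x (t i * c * t i')} := by
    refine map_mem_of_supportedIn (ht i') (LinearMap.mulLeft K (f i * mon K c)) _ fun b hb => ?_
    simpa [mul_assoc] using mem_multiplesIn (K := K) (f := f) (t := t)
      (S := {x | r x (t i * c * t i')}) 1 i (c * b)
      (by simpa [mul_assoc] using hr.mul_left (t i * c) _ _ hb)
  have h2 : (f i - mon K (t i)) * (mon K c * f i') ∈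
      multiplesIn f t {x | r x (t i * c * t i')} := by
    refine map_mem_of_supportedIn (ht i) (LinearMap.mulRight K (mon K c * f i')) _ fun b hb => ?_
    simpa [mul_assoc] using mem_multiplesIn (K := K) (f := f) (t := t)
      (S := {x | r x (t i * c * t i')}) (b * c) i' 1
      (by simpa [mul_assoc] using hr.mul_right (c * t i') _ _ hb)
  -- `f c t' - t c f' = (f - t) c f' - f c (f' - t')`
  convert sub_mem h2 h1 using 1
  simp only [map_mul]
  noncomm_ring

/-- Buchberger's criterion for quadratic tips `x i * y i`: only pairs with equal tips and pairs
whose tips overlap in one letter have to be checked. -/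
theorem syzygiesResolve_of_quadratic (hr : IsMonomialOrder r) {x y : ι → X}
    (hxy : ∀ i, t i = FreeMonoid.of (x i) * FreeMonoid.of (y i))
    (ht : ∀ i, f i - mon K (t i) ∈ supportedIn K {b | r b (t i)})
    (heq : ∀ i i', x i = x i' → y i = y i' → f i - f i' ∈ multiplesIn f t {b | r b (t i)})
    (hov : ∀ i i', y i = x i' →
      f i * mon K (FreeMonoid.of (y i')) - mon K (FreeMonoid.of (x i)) * f i' ∈
        multiplesIn f t {b | r b (t i * FreeMonoid.of (y i'))}) :
    SyzygiesResolve r f t := by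
  -- by symmetry the first tip may be assumed to start no later than the second
  have key : ∀ (a : FreeMonoid X) i b c i' b', t i * b = c * t i' * b' →
      mon K a * f i * mon K b - mon K (a * c) * f i' * mon K b' ∈
        multiplesIn f t {w | r w (a * t i * b)} := by
    intro a i b c i' b' h
    rw [hxy, hxy] at h
    induction c using FreeMonoid.casesOn with
    | one =>
      have h' : x i :: y i :: b.toList = x i' :: y i' :: b'.toList := by
        simpa using congrArg FreeMonoid.toList h
      simp only [List.cons.injEq] at h'
      obtain ⟨hx, hy, hb⟩ := h'
      obtain rfl : b = b' := FreeMonoid.toList.injective hb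
      have := mon_mul_mul_mon_mem_multiplesIn hr (heq i i' hx hy) a b
      simpa [mul_sub, sub_mul] using this
    | of_mul z c =>
      induction c using FreeMonoid.casesOn with
      | one =>
        have h' : x i :: y i :: b.toList = z :: x i' :: y i' :: b'.toList := by
          simpa using congrArg FreeMonoid.toList h
        simp only [List.cons.injEq] at h'
        obtain ⟨rfl, hy, hb⟩ := h'
        obtain rfl : b = FreeMonoid.of (y i') * b' :=
          FreeMonoid.toList.injective (by simpa using hb)
        have := mon_mul_mul_mon_mem_multiplesIn hr (hov i i' hy) a b'
        simpa [mul_sub, sub_mul, mul_assoc] using this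
      | of_mul z' c =>
        have h' : x i :: y i :: b.toList = z :: z' :: (c.toList ++ x i' :: y i' :: b'.toList) := by
          simpa using congrArg FreeMonoid.toList h
        simp only [List.cons.injEq] at h'
        obtain ⟨rfl, rfl, hb⟩ := h'
        obtain rfl : b = c * t i' * b' := FreeMonoid.toList.injective (by simpa [hxy] using hb)
        have := mon_mul_mul_mon_mem_multiplesIn hr (disjoint_syzygy_mem hr ht c i i') a b'
        rw [← mul_assoc (FreeMonoid.of (x i)), ← hxy]
        simpa [mul_sub, sub_mul, mul_assoc] using this
  intro a i b a' i' b' h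
  have hl : a.toList ++ (t i * b).toList = a'.toList ++ (t i' * b').toList := by
    simpa [mul_assoc] using congrArg FreeMonoid.toList h
  rcases List.append_eq_append_iff.1 hl with ⟨c, hc, hb⟩ | ⟨c, hc, hb⟩
  · obtain rfl : a' = a * FreeMonoid.ofList c := FreeMonoid.toList.injective (by simpa using hc)
    exact key a i b (FreeMonoid.ofList c) i' b'
      (FreeMonoid.toList.injective (by simpa [mul_assoc] using hb))
  · obtain rfl : a = a' * FreeMonoid.ofList c := FreeMonoid.toList.injective (by simpa using hc)
    rw [h, ← neg_mem_iff, neg_sub]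
    exact key a' i' b' (FreeMonoid.ofList c) i b
      (FreeMonoid.toList.injective (by simpa [mul_assoc] using hb))

/-! ### Uniqueness of reduced Gröbner bases -/

/-- An element of a reduced Gröbner basis is determined by its tip, so one reduced Gröbner basis
is contained in any other: the difference of two elements with a common tip would have a tip that
occurs in one of them and is divisible by the tip of a basis element. -/
theorem IsReducedGroebnerBasis.subset (hr : IsMonomialOrder r)
    {I : TwoSidedIdeal (FreeAlgebra K X)} {G H : Set (FreeAlgebra K X)}
    (hG : IsReducedGroebnerBasis r I G) (hH : IsReducedGroebnerBasis r I H) : G ⊆ H := by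
  obtain ⟨⟨⟨hGI, hGt⟩, hG0, hGm⟩, hG1, hGr⟩ := hG
  obtain ⟨⟨⟨hHI, hHt⟩, hH0, hHm⟩, hH1, hHr⟩ := hH
  intro g hg
  obtain ⟨w, hw⟩ := exists_isTip hr (p := g) fun e => hG0 (e ▸ hg)
  obtain ⟨w₁, ⟨h, hh, hw₁⟩, hd₁⟩ : w ∈ monoidalSpan (tips r H) :=
    hHt ▸ ⟨g, hGI hg, hw⟩
  obtain ⟨w₂, ⟨g', hg', hw₂⟩, hd₂⟩ : w₁ ∈ monoidalSpan (tips r G) :=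
    hGt ▸ ⟨h, hHI hh, hw₁⟩
  obtain rfl : g' = g := by
    by_contra hne
    exact hGm g' hg' g hg hne _ _ hw₂ hw (hd₂.trans hd₁)
  obtain rfl := hw₂.unique hr hw
  obtain rfl := hd₁.antisymm hd₂
  suffices g' = h by rwa [this]
  by_contra hne
  obtain ⟨b, hb⟩ := exists_isTip hr (sub_ne_zero.2 hne)
  have hbw : r b w₁ := by
    have hne' : b ≠ w₁ := by
      rintro rfl
      exact hb.1 (by rw [coeff_sub, hG1 g' hg _ hw, hH1 h hh _ hw₁, sub_self])
    by_cases e : coeff g' b = 0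
    · exact (hw₁.2 b fun e' => hb.1 (by simp [e, e'])).resolve_left hne'
    · exact (hw.2 b e).resolve_left hne'
  have hmem : g' - h ∈ I := I.sub_mem (hGI hg) (hHI hh)
  by_cases e : coeff g' b = 0
  · obtain ⟨w', ⟨q, hq, hw'⟩, hd⟩ : b ∈ monoidalSpan (tips r H) := hHt ▸ ⟨_, hmem, hb⟩
    by_cases hqh : q = h
    · subst hqh
      obtain rfl := hw'.unique hr hw₁
      exact hr.not_lt_of_divides hd hbw
    · exact hHr q hq h hh hqh _ _ hw' (fun e' => hb.1 (by simp [e, e'])) hd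
  · obtain ⟨w', ⟨q, hq, hw'⟩, hd⟩ : b ∈ monoidalSpan (tips r G) := hGt ▸ ⟨_, hmem, hb⟩
    by_cases hqh : q = g'
    · subst hqh
      obtain rfl := hw'.unique hr hw
      exact hr.not_lt_of_divides hd hbw
    · exact hGr q hq g' hg hqh _ _ hw' e hd

end General

/-! ### The order on the monomials -/

section Order

variable {n : ℕ}

/-- An order embedding of the generators into a lexicographic sum: the `u_{j,i}^*` with the
reversed lexicographic order, followed by the `u_{j,i}`. -/
def Gen.key : Gen n → (Fin n ×ₗ Fin n)ᵒᵈ ⊕ₗ (Fin n ×ₗ Fin n)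
  | .ustar j i => Sum.inlₗ (OrderDual.toDual (toLex (j, i)))
  | .u j i => Sum.inrₗ (toLex (j, i))

theorem Gen.key_injective : Function.Injective (Gen.key (n := n)) := by
  rintro (⟨j, i⟩ | ⟨j, i⟩) (⟨t, s⟩ | ⟨t, s⟩) h <;> simp_all [Gen.key]

theorem Gen.lt_iff_key (a b : Gen n) : Gen.lt a b ↔ a.key < b.key := by
  rcases a with ⟨j, i⟩ | ⟨j, i⟩ <;> rcases b with ⟨t, s⟩ | ⟨t, s⟩ <;>
    simp [Gen.key, Gen.lt, Prod.lex_def, Prod.Lex.toLex_lt_toLex]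

theorem Gen.lt_eq_invImage : Gen.lt (n := n) = InvImage (· < ·) Gen.key := by
  ext a b
  exact Gen.lt_iff_key a b

theorem Gen.wellFounded_lt : WellFounded (Gen.lt (n := n)) := by
  have : Finite ((Fin n ×ₗ Fin n)ᵒᵈ ⊕ₗ (Fin n ×ₗ Fin n)) :=
    inferInstanceAs (Finite ((Fin n × Fin n) ⊕ (Fin n × Fin n)))
  rw [Gen.lt_eq_invImage]
  exact InvImage.wf _ (Finite.wellFounded_of_trans_of_irrefl _)

theorem Gen.trichotomous_lt : Std.Trichotomous (Gen.lt (n := n)) := by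
  rw [Gen.lt_eq_invImage]
  exact InvImage.trichotomous Gen.key_injective

/-- Shortlex orders are compatible with multiplication from the right. -/
theorem shortlex_append_of_shortlex {α : Type*} {r : α → α → Prop} {s t : List α}
    (h : List.Shortlex r s t) (l : List α) : List.Shortlex r (s ++ l) (t ++ l) := by
  rcases List.shortlex_def.1 h with h | ⟨hl, h⟩
  · exact .of_length_lt (by simpa using h)
  · refine .of_lex (by simpa using hl) ?_
    clear * - h hl
    induction h with
    | nil => simp at hl
    | cons _ ih => exact .cons (ih (by simpa using hl))
    | rel h => exact .rel h

theorem isMonomialOrder_monLT : IsMonomialOrder (monLT n) where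
  isWellOrder := by
    have := Gen.trichotomous_lt (n := n)
    exact { wf := List.Shortlex.wf Gen.wellFounded_lt
            trichotomous := (List.Shortlex.trichotomous (r := Gen.lt (n := n))).trichotomous }
  mul_left c b b' h := List.Shortlex.append_left (s := c.toList) h
  mul_right c b b' h := shortlex_append_of_shortlex h c.toList

theorem monLT_of_mul_of {x x' : Gen n} (h : Gen.lt x x') (y y' : Gen n) :
    monLT n (FreeMonoid.of x * FreeMonoid.of y) (FreeMonoid.of x' * FreeMonoid.of y') :=
  .of_lex rfl (.rel h)

theorem monLT_one {w : FreeMonoid (Gen n)} (h : w ≠ 1) : monLT n 1 w :=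
  .of_length_lt (List.length_pos_of_ne_nil h)

end Order

/-! ### The four matrices -/

section Matrices

variable {n : ℕ} {v w : Matrix (Fin n) (Fin n) (Gen n)}

@[simp] theorem Gen.adj_adj (x : Gen n) : x.adj.adj = x := by cases x <;> rfl

theorem skewDagger_skewDagger : skewDagger (skewDagger v) = v := by
  ext j i
  simp [skewDagger]

theorem skewDagger_skewStar : skewDagger (skewStar v) = v.transpose := by
  ext j i
  simp [skewDagger, skewStar]

theorem transpose_mem_matrices (hv : v ∈ matrices n) : v.transpose ∈ matrices n := by
  rcases hv with rfl | rfl | rfl | rfl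
  · exact .inr (.inl rfl)
  · exact .inl rfl
  · exact .inr (.inr (.inr rfl))
  · exact .inr (.inr (.inl rfl))

theorem skewDagger_mem_matrices (hv : v ∈ matrices n) : skewDagger v ∈ matrices n := by
  rcases hv with rfl | rfl | rfl | rfl
  · exact .inr (.inr (.inr rfl))
  · exact .inr (.inr (.inl rfl))
  · exact .inr (.inl skewDagger_skewStar)
  · exact .inl skewDagger_skewDagger

/-- In each of the four matrices the entries increase along every row. -/
theorem lt_of_mem_matrices (hv : v ∈ matrices n) (j : Fin n) {i i' : Fin n} (h : i < i') :
    Gen.lt (v j i) (v j i') := by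
  rcases hv with rfl | rfl | rfl | rfl <;>
    simp [matU, skewStar, skewDagger, Gen.adj, Gen.lt, Prod.lex_def, h]

/-- In each of the four matrices the entries increase down every column. -/
theorem lt_of_mem_matrices' (hv : v ∈ matrices n) (i : Fin n) {j j' : Fin n} (h : j < j') :
    Gen.lt (v j i) (v j' i) :=
  lt_of_mem_matrices (transpose_mem_matrices hv) i h

/-- The order within a column is reversed by the adjoint, since the columns of adjoints are, read
backwards, rows of `v^‡`. -/
theorem adj_lt_of_mem_matrices (hv : v ∈ matrices n) (i : Fin n) {j j' : Fin n} (h : j' < j) :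
    Gen.lt (v j i).adj (v j' i).adj := by
  simpa [skewDagger] using
    lt_of_mem_matrices (skewDagger_mem_matrices hv) i.rev (Fin.rev_lt_rev.2 h)

theorem apply_injective (hv : v ∈ matrices n) {j i j' i' : Fin n} (h : v j i = v j' i') :
    j = j' ∧ i = i' := by
  rcases hv with rfl | rfl | rfl | rfl <;>
    simp_all [matU, skewStar, skewDagger, Gen.adj]

theorem adj_injective : Function.Injective (Gen.adj (n := n)) :=
  fun x y h => by simpa using congrArg Gen.adj h

/-- The word `v_{j,s} v_{i,s}^*`. -/
def relWord (v : Matrix (Fin n) (Fin n) (Gen n)) (j i s : Fin n) : FreeMonoid (Gen n) :=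
  FreeMonoid.of (v j s) * FreeMonoid.of (v i s).adj

theorem relWord_eq_iff {j i s j' i' s' : Fin n} :
    relWord v j i s = relWord w j' i' s' ↔ v j s = w j' s' ∧ v i s = w i' s' := by
  have : relWord v j i s = relWord w j' i' s' ↔
      [v j s, (v i s).adj] = [w j' s', (w i' s').adj] := Iff.rfl
  simp [this, adj_injective.eq_iff]

theorem relWord_ne_one (j i s : Fin n) : relWord v j i s ≠ 1 := fun h => by
  simpa [relWord] using congrArg FreeMonoid.length h

variable [NeZero n]

theorem lastIdx_rev : (lastIdx n).rev = 0 := Fin.rev_rev 0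

theorem le_lastIdx (i : Fin n) : i ≤ lastIdx n := by
  rw [← Fin.rev_le_rev, lastIdx_rev]
  exact Fin.zero_le _

theorem lt_lastIdx {i : Fin n} (h : i ≠ lastIdx n) : i < lastIdx n :=
  lt_of_le_of_ne (le_lastIdx i) h

theorem lastIdx_ne_zero (hn : 2 ≤ n) : lastIdx n ≠ 0 := by
  intro h
  have := congrArg Fin.val h
  simp [lastIdx, Fin.val_rev] at this
  omega

theorem rev_ne_lastIdx {i : Fin n} : i.rev ≠ lastIdx n ↔ i ≠ 0 := by
  simp [lastIdx]

theorem tipWord_eq_relWord (v : Matrix (Fin n) (Fin n) (Gen n)) (j i : Fin n) :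
    tipWord v j i = relWord v j i (lastIdx n) := by
  simp [tipWord, relWord, skewDagger, lastIdx]

/-- The tips of the relations are pairwise distinct, except that `r^v_{n,n}` and `r^{v^T}_{n,n}`
share theirs. -/
theorem relWord_lastIdx_congr {j i j' i' : Fin n} (hv : v ∈ matrices n) (hw : w ∈ matrices n)
    (h1 : v j (lastIdx n) = w j' (lastIdx n)) (h2 : v i (lastIdx n) = w i' (lastIdx n)) :
    (v = w ∧ j = j' ∧ i = i') ∨
      (w = v.transpose ∧ j = lastIdx n ∧ j' = lastIdx n ∧ i = lastIdx n ∧ i' = lastIdx n) := by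
  rcases hv with rfl | rfl | rfl | rfl <;> rcases hw with rfl | rfl | rfl | rfl <;>
    simp_all [matU, skewStar, skewDagger, Gen.adj] <;> right <;> rfl

/-- Among the monomials of the relations that are not their tips, those equal to the tip of some
relation occur only in the elements `r^v_{n,n}`. -/
theorem relWord_eq_relWord_lastIdx {j i s j' i' : Fin n} (hv : v ∈ matrices n)
    (hw : w ∈ matrices n) (h : relWord v j i s = relWord w j' i' (lastIdx n)) :
    s = lastIdx n ∨ (j = lastIdx n ∧ i = lastIdx n) := by
  obtain ⟨h1, h2⟩ := relWord_eq_iff.1 h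
  rcases hv with rfl | rfl | rfl | rfl <;> rcases hw with rfl | rfl | rfl | rfl <;>
    simp_all [matU, skewStar, skewDagger, Gen.adj]

/-- Two tips overlap only in the form `v_{j,n} v_{1,n}^* v_{1,i}`, where the second one is a tip
for `v^‡`. -/
theorem overlap_cases (hn : 2 ≤ n) {i j' : Fin n} (hv : v ∈ matrices n) (hw : w ∈ matrices n)
    (h : (v i (lastIdx n)).adj = w j' (lastIdx n)) : w = skewDagger v ∧ i = 0 ∧ j' = 0 := by
  have h0 := lastIdx_ne_zero hn
  have h0' := h0.symm
  have hr : ∀ x : Fin n, x.rev = lastIdx n ↔ x = 0 := fun x => by simp [lastIdx]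
  have hr' : ∀ x : Fin n, lastIdx n = x.rev ↔ x = 0 := fun x => by simp [lastIdx, eq_comm]
  have hs : ∀ x : Fin n, x.rev = 0 ↔ x = lastIdx n := fun x => by
    rw [← lastIdx_rev, Fin.rev_inj]
  have hs' : ∀ x : Fin n, 0 = x.rev ↔ x = lastIdx n := fun x => by
    rw [eq_comm, hs]
  rcases hv with rfl | rfl | rfl | rfl <;> rcases hw with rfl | rfl | rfl | rfl <;>
    simp_all [matU, skewStar, skewDagger, Gen.adj, lastIdx_rev]
  exacts [rfl, skewDagger_skewStar.symm, skewDagger_skewDagger.symm]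

end Matrices

/-! ### The relations -/

section Relations

variable (K : Type*) [Field K] {n : ℕ} {v w : Matrix (Fin n) (Fin n) (Gen n)}

theorem mon_of (x : Gen n) : mon K (FreeMonoid.of x) = gen K x := by
  simp [mon, gen]

theorem mon_relWord (v : Matrix (Fin n) (Fin n) (Gen n)) (j i s : Fin n) :
    mon K (relWord v j i s) = gen K (v j s) * gen K (v i s).adj := by
  simp [relWord, mon_of]

theorem rel_eq (v : Matrix (Fin n) (Fin n) (Gen n)) (j i : Fin n) :
    rel K v j i = (∑ s, gen K (v j s) * gen K (v i s).adj) - if j = i then 1 else 0 := by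
  rw [rel, ← Equiv.sum_comp Fin.revPerm (fun s => gen K (v j s) * gen K (v i s).adj)]
  simp [skewDagger]

theorem rel_skewDagger_rev (v : Matrix (Fin n) (Fin n) (Gen n)) (j i : Fin n) :
    rel K (skewDagger v) j.rev i.rev =
      (∑ s, gen K (v s j).adj * gen K (v s i)) - if j = i then 1 else 0 := by
  rw [rel_eq, ← Equiv.sum_comp Fin.revPerm]
  simp [skewDagger]

/-- Both sides are `v v^* v - v`, where `v^*` is the conjugate transpose. -/
theorem sum_rel_mul_eq (v : Matrix (Fin n) (Fin n) (Gen n)) (j k : Fin n) :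
    ∑ t, rel K v j t * gen K (v t k) =
      ∑ s, gen K (v j s) * rel K (skewDagger v) s.rev k.rev := by
  simp only [rel_eq K v, rel_skewDagger_rev, sub_mul, mul_sub, Finset.sum_sub_distrib, ite_mul,
    mul_ite, Finset.sum_mul, Finset.mul_sum]
  rw [Finset.sum_comm]
  simp [mul_assoc]

/-- Both sides are the sum of all `v_{i,s} v_{i,s}^* - n`. -/
theorem sum_rel_diag_eq (v : Matrix (Fin n) (Fin n) (Gen n)) :
    ∑ i, rel K v i i = ∑ i, rel K v.transpose i i := by
  simp only [rel_eq, Finset.sum_sub_distrib, Matrix.transpose_apply]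
  rw [Finset.sum_comm]

/-- Splits a chosen quadratic monomial off a relation. -/
theorem rel_sub_mon_mem (v : Matrix (Fin n) (Fin n) (Gen n)) (j i k : Fin n) :
    rel K v j i - mon K (relWord v j i k) ∈
      supportedIn K {b | b = 1 ∨ ∃ s, s ≠ k ∧ b = relWord v j i s} := by
  rw [rel_eq]
  simp only [← mon_relWord]
  rw [← Finset.add_sum_erase _ _ (Finset.mem_univ k), sub_sub, add_comm _ (mon K _),
    add_sub_add_left_eq_sub]
  refine sub_mem (sum_mem fun s hs => mon_mem_supportedIn ?_) ?_
  · exact .inr ⟨s, Finset.ne_of_mem_erase hs, rfl⟩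
  · split_ifs
    · rw [← map_one (mon K)]
      exact mon_mem_supportedIn (.inl rfl)
    · exact zero_mem _

theorem eq_of_coeff_rel_ne_zero {j i : Fin n} {b : FreeMonoid (Gen n)}
    (h : coeff (rel K v j i) b ≠ 0) : b = 1 ∨ ∃ s, b = relWord v j i s := by
  by_cases e : b = relWord v j i j
  · exact .inr ⟨j, e⟩
  · rcases rel_sub_mon_mem K v j i j b (by simpa [coeff_mon_of_ne (Ne.symm e)] using h) with
      h | ⟨s, -, h⟩
    exacts [.inl h, .inr ⟨s, h⟩]

variable (n) in
/-- The defining relations as a family indexed by the matrix and the two matrix indices. -/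
noncomputable def relFamily (x : matrices n × Fin n × Fin n) : FreeAlgebra K (Gen n) :=
  rel K x.1.1 x.2.1 x.2.2

theorem range_relFamily : Set.range (relFamily K n) = rels K n := by
  ext p
  constructor
  · rintro ⟨⟨⟨v, hv⟩, j, i⟩, rfl⟩
    exact ⟨v, hv, j, i, rfl⟩
  · rintro ⟨v, hv, j, i, rfl⟩
    exact ⟨⟨⟨v, hv⟩, j, i⟩, rfl⟩

variable [NeZero n]

theorem rel_sub_tip_mem (hv : v ∈ matrices n) (j i : Fin n) :
    rel K v j i - mon K (tipWord v j i) ∈ supportedIn K {b | monLT n b (tipWord v j i)} := by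
  rw [tipWord_eq_relWord]
  refine supportedIn_mono ?_ (rel_sub_mon_mem K v j i (lastIdx n))
  rintro _ (rfl | ⟨s, hs, rfl⟩)
  · exact monLT_one (relWord_ne_one _ _ _)
  · exact monLT_of_mul_of (lt_of_mem_matrices hv j (lt_lastIdx hs)) _ _

theorem isTip_rel (hv : v ∈ matrices n) (j i : Fin n) :
    IsTip (monLT n) (rel K v j i) (tipWord v j i) ∧ coeff (rel K v j i) (tipWord v j i) = 1 :=
  isTip_of_sub_mem isMonomialOrder_monLT one_ne_zero (by simpa using rel_sub_tip_mem K hv j i)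

variable (n) in
/-- The tips of the members of `relFamily`. -/
def tipFamily (x : matrices n × Fin n × Fin n) : FreeMonoid (Gen n) :=
  tipWord x.1.1 x.2.1 x.2.2

theorem mem_multiplesIn_relFamily {S : Set (FreeMonoid (Gen n))} (hv : v ∈ matrices n)
    (j i : Fin n) (h : tipWord v j i ∈ S) :
    rel K v j i ∈ multiplesIn (relFamily K n) (tipFamily n) S := by
  simpa using! mem_multiplesIn (K := K) (f := relFamily K n) (t := tipFamily n) 1
    (⟨v, hv⟩, j, i) 1 (S := S) (by simpa [tipFamily] using h)

/-- The relations `r^v_{n,n}` and `r^{v^T}_{n,n}` with their common tip resolve, because the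
traces of the relations for `v` and `v^T` agree. -/
theorem rel_sub_rel_transpose_mem (hv : v ∈ matrices n) :
    rel K v (lastIdx n) (lastIdx n) - rel K v.transpose (lastIdx n) (lastIdx n) ∈
      multiplesIn (relFamily K n) (tipFamily n)
        {b | monLT n b (tipWord v (lastIdx n) (lastIdx n))} := by
  have h := sum_rel_diag_eq K v
  rw [← Finset.add_sum_erase _ _ (Finset.mem_univ (lastIdx n)),
    ← Finset.add_sum_erase _ _ (Finset.mem_univ (lastIdx n))] at h
  rw [sub_eq_sub_iff_add_eq_add.2 (h.trans (add_comm _ _))]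
  have hvT := transpose_mem_matrices hv
  refine sub_mem (sum_mem fun s hs => ?_) (sum_mem fun s hs => ?_) <;>
    have hs' := lt_lastIdx (Finset.ne_of_mem_erase hs)
  · refine mem_multiplesIn_relFamily K hvT s s ?_
    rw [Set.mem_ofPred_eq, tipWord_eq_relWord, tipWord_eq_relWord]
    exact monLT_of_mul_of (lt_of_mem_matrices hv _ hs') _ _
  · refine mem_multiplesIn_relFamily K hv s s ?_
    rw [Set.mem_ofPred_eq, tipWord_eq_relWord, tipWord_eq_relWord]
    exact monLT_of_mul_of (lt_of_mem_matrices' hv _ hs') _ _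

/-- The overlap `v_{j,n} v_{1,n}^* v_{1,k}` resolves, because `(v v^*) v = v (v^* v)`. -/
theorem overlap_mem (hv : v ∈ matrices n) (j k : Fin n) :
    rel K v j 0 * gen K (v 0 k) - gen K (v j (lastIdx n)) * rel K (skewDagger v) 0 k.rev ∈
      multiplesIn (relFamily K n) (tipFamily n)
        {b | monLT n b (tipWord v j 0 * FreeMonoid.of (v 0 k))} := by
  have h := sum_rel_mul_eq K v j k
  rw [← Finset.add_sum_erase _ _ (Finset.mem_univ (0 : Fin n)),
    ← Finset.add_sum_erase _ (fun s => gen K (v j s) * _) (Finset.mem_univ (lastIdx n)),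
    lastIdx_rev] at h
  rw [sub_eq_sub_iff_add_eq_add.2 (h.trans (add_comm _ _))]
  refine sub_mem (sum_mem fun s hs => ?_) (sum_mem fun t ht => ?_)
  · have hs' := lt_lastIdx (Finset.ne_of_mem_erase hs)
    have := mem_multiplesIn (K := K) (f := relFamily K n) (t := tipFamily n)
      (S := {b | monLT n b (tipWord v j 0 * FreeMonoid.of (v 0 k))})
      (FreeMonoid.of (v j s)) (⟨skewDagger v, skewDagger_mem_matrices hv⟩, s.rev, k.rev) 1
      (.of_lex rfl (.rel (lt_of_mem_matrices hv j hs')))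
    simpa [mon_of, relFamily] using this
  · have ht' : 0 < t := Fin.pos_iff_ne_zero.2 (Finset.ne_of_mem_erase ht)
    have := mem_multiplesIn (K := K) (f := relFamily K n) (t := tipFamily n)
      (S := {b | monLT n b (tipWord v j 0 * FreeMonoid.of (v 0 k))})
      1 (⟨v, hv⟩, j, t) (FreeMonoid.of (v t k)) (by
        simp only [tipFamily, tipWord_eq_relWord, one_mul]
        exact .of_lex rfl (.cons (.rel (adj_lt_of_mem_matrices hv _ ht'))))
    simpa [mon_of, relFamily] using this

theorem isGroebnerBasis_rels (hn : 2 ≤ n) :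
    IsGroebnerBasis (monLT n) (relIdeal K n) (rels K n) := by
  have ht : ∀ x, relFamily K n x - mon K (tipFamily n x) ∈
      supportedIn K {b | monLT n b (tipFamily n x)} := fun x => rel_sub_tip_mem K x.1.2 _ _
  rw [relIdeal, ← range_relFamily]
  refine isGroebnerBasis_of_syzygiesResolve isMonomialOrder_monLT ht
    (syzygiesResolve_of_quadratic isMonomialOrder_monLT
      (x := fun x => x.1.1 x.2.1 (lastIdx n)) (y := fun x => (x.1.1 x.2.2 (lastIdx n)).adj)
      (fun x => tipWord_eq_relWord _ _ _) ht ?_ ?_)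
  · rintro ⟨⟨v, hv⟩, j, i⟩ ⟨⟨w, hw⟩, j', i'⟩ h1 h2
    rcases relWord_lastIdx_congr hv hw h1 (adj_injective h2) with
      ⟨rfl, rfl, rfl⟩ | ⟨rfl, rfl, rfl, rfl, rfl⟩
    · rw [sub_self]
      exact zero_mem _
    · exact rel_sub_rel_transpose_mem K hv
  · rintro ⟨⟨v, hv⟩, j, i⟩ ⟨⟨w, hw⟩, j', i'⟩ h
    obtain ⟨rfl, rfl, rfl⟩ := overlap_cases hn hv hw h
    have := overlap_mem K hv j i'.rev
    rw [Fin.rev_rev] at this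
    simpa [mon_of, skewDagger, lastIdx_rev, relFamily, tipFamily] using this

theorem tips_rels :
    tips (monLT n) (rels K n) = {b | ∃ v ∈ matrices n, ∃ j i : Fin n, b = tipWord v j i} := by
  ext b
  constructor
  · rintro ⟨_, ⟨v, hv, j, i, rfl⟩, hb⟩
    exact ⟨v, hv, j, i, hb.unique isMonomialOrder_monLT (isTip_rel K hv j i).1⟩
  · rintro ⟨v, hv, j, i, rfl⟩
    exact ⟨_, ⟨v, hv, j, i, rfl⟩, (isTip_rel K hv j i).1⟩

/-- `r^u_{n,n}` and `r^{u^T}_{n,n}` are different elements with the same tip. -/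
theorem not_isMinimalGroebnerBasis_rels (hn : 2 ≤ n) :
    ¬ IsMinimalGroebnerBasis (monLT n) (relIdeal K n) (rels K n) := by
  rintro ⟨-, -, h⟩
  have hu : matU n ∈ matrices n := .inl rfl
  have huT := transpose_mem_matrices hu
  refine h _ ⟨_, hu, lastIdx n, lastIdx n, rfl⟩ _ ⟨_, huT, lastIdx n, lastIdx n, rfl⟩ ?_ _ _
    (isTip_rel K hu _ _).1 (isTip_rel K huT _ _).1 ⟨1, 1, by simp [tipWord_eq_relWord, relWord]⟩
  intro heq
  -- the two elements differ in the coefficient of `u_{n,1} u_{n,1}^*`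
  have h1 : coeff (rel K (matU n) (lastIdx n) (lastIdx n))
      (relWord (matU n) (lastIdx n) (lastIdx n) 0) ≠ 0 := by
    intro h0
    rcases rel_sub_mon_mem K (matU n) (lastIdx n) (lastIdx n) 0
      (relWord (matU n) (lastIdx n) (lastIdx n) 0) (by simp [h0, coeff_mon_self]) with
      h | ⟨s, hs, h⟩
    · exact relWord_ne_one _ _ _ h
    · exact hs (apply_injective hu (relWord_eq_iff.1 h).1).2.symm
  rw [heq] at h1
  rcases eq_of_coeff_rel_ne_zero K h1 with h | ⟨s, h⟩
  · exact relWord_ne_one _ _ _ h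
  · exact lastIdx_ne_zero hn (apply_injective hu (relWord_eq_iff.1 h).1).2.symm

/-! ### The reduced Gröbner basis -/

theorem modRel_eq (v : Matrix (Fin n) (Fin n) (Gen n)) :
    modRel K v = mon K (relWord v (lastIdx n) (lastIdx n) (lastIdx n)) -
      ((∑ s ∈ Finset.univ.erase (lastIdx n), ∑ t ∈ Finset.univ.erase (lastIdx n),
        mon K (relWord v t t s)) - algebraMap K (FreeAlgebra K (Gen n)) ((n : K) - 2)) := by
  have h : ∑ s ∈ Finset.univ.filter (fun s : Fin n => s ≠ 0),
      ∑ t ∈ Finset.univ.filter (fun t : Fin n => t ≠ lastIdx n),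
        gen K (v t s.rev) * gen K (skewDagger v s t.rev) =
      ∑ s ∈ Finset.univ.erase (lastIdx n), ∑ t ∈ Finset.univ.erase (lastIdx n),
        mon K (relWord v t t s) := by
    refine Finset.sum_equiv Fin.revPerm (fun s => by simp [rev_ne_lastIdx]) fun s _ => ?_
    refine Finset.sum_congr (by ext; simp) fun t _ => ?_
    simp [mon_relWord, skewDagger]
  rw [modRel, h, mon_relWord]
  simp [skewDagger, lastIdx]

theorem modRel_transpose (v : Matrix (Fin n) (Fin n) (Gen n)) :
    modRel K v.transpose = modRel K v := by
  rw [modRel_eq, modRel_eq, Finset.sum_comm]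
  rfl

/-- The modified element arises from `r^v_{n,n}` by reducing each `v_{n,s} v_{n,s}^*` with `s ≠ n`,
which is the tip of `r^{v^T}_{s,s}`. -/
theorem modRel_eq_rel_sub (v : Matrix (Fin n) (Fin n) (Gen n)) :
    modRel K v = rel K v (lastIdx n) (lastIdx n) -
      ∑ s ∈ Finset.univ.erase (lastIdx n), rel K v.transpose s s := by
  have hcard : (Finset.univ.erase (lastIdx n)).card + 1 = n := by
    rw [Finset.card_erase_add_one (Finset.mem_univ _), Finset.card_univ, Fintype.card_fin]
  have hcast : ((n : K) - 2) = ((Finset.univ.erase (lastIdx n)).card : K) - 1 := by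
    have := congrArg (Nat.cast (R := K)) hcard
    push_cast at this
    rw [← this]
    ring
  simp only [modRel_eq, rel_eq, if_true, Matrix.transpose_apply, ← mon_relWord, hcast]
  simp only [Finset.sum_sub_distrib]
  rw [← Finset.add_sum_erase _ _ (Finset.mem_univ (lastIdx n))]
  simp only [← Finset.add_sum_erase _ (fun t => mon K (relWord v t t _))
    (Finset.mem_univ (lastIdx n)), Finset.sum_add_distrib]
  simp
  abel

theorem modRel_mem (hv : v ∈ matrices n) : modRel K v ∈ relIdeal K n := by
  have h : ∀ w ∈ matrices n, ∀ j i, rel K w j i ∈ relIdeal K n := fun w hw j i =>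
    TwoSidedIdeal.subset_span ⟨w, hw, j, i, rfl⟩
  rw [modRel_eq_rel_sub]
  exact sub_mem (h _ hv _ _) (sum_mem fun s _ => h _ (transpose_mem_matrices hv) _ _)

theorem modRel_sub_tip_mem (v : Matrix (Fin n) (Fin n) (Gen n)) :
    modRel K v - mon K (tipWord v (lastIdx n) (lastIdx n)) ∈ supportedIn K
      {b | b = 1 ∨ ∃ s t, s ≠ lastIdx n ∧ t ≠ lastIdx n ∧ b = relWord v t t s} := by
  rw [modRel_eq, tipWord_eq_relWord, sub_sub_cancel_left, neg_mem_iff]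
  refine sub_mem (sum_mem fun s hs => sum_mem fun t ht => mon_mem_supportedIn (.inr
    ⟨s, t, Finset.ne_of_mem_erase hs, Finset.ne_of_mem_erase ht, rfl⟩)) ?_
  rw [Algebra.algebraMap_eq_smul_one, ← map_one (mon K)]
  exact Submodule.smul_mem _ _ (mon_mem_supportedIn (.inl rfl))

theorem isTip_modRel (hv : v ∈ matrices n) :
    IsTip (monLT n) (modRel K v) (tipWord v (lastIdx n) (lastIdx n)) ∧
      coeff (modRel K v) (tipWord v (lastIdx n) (lastIdx n)) = 1 := by
  refine isTip_of_sub_mem isMonomialOrder_monLT one_ne_zero ?_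
  rw [one_smul]
  refine supportedIn_mono ?_ (modRel_sub_tip_mem K v)
  rw [tipWord_eq_relWord]
  rintro _ (rfl | ⟨s, t, hs, ht, rfl⟩)
  · exact monLT_one (relWord_ne_one _ _ _)
  · have := isMonomialOrder_monLT (n := n)
    exact this.trans (monLT_of_mul_of (lt_of_mem_matrices hv t (lt_lastIdx hs)) _ (v t s).adj)
      (monLT_of_mul_of (lt_of_mem_matrices' hv _ (lt_lastIdx ht)) _ _)

theorem eq_of_coeff_modRel_ne_zero {b : FreeMonoid (Gen n)} (h : coeff (modRel K v) b ≠ 0) :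
    b = 1 ∨ b = tipWord v (lastIdx n) (lastIdx n) ∨
      ∃ s t, s ≠ lastIdx n ∧ t ≠ lastIdx n ∧ b = relWord v t t s := by
  by_cases e : b = tipWord v (lastIdx n) (lastIdx n)
  · exact .inr (.inl e)
  · rcases modRel_sub_tip_mem K v b (by simpa [coeff_mon_of_ne (Ne.symm e)] using h) with h | h
    exacts [.inl h, .inr (.inr h)]

/-- Every element of the modified set is monic, its tip is one of the words `tipWord v j i`, and
among these words only its tip divides any of its monomials. -/
theorem exists_tipWord_of_mem_redBasis {g : FreeAlgebra K (Gen n)} (hg : g ∈ redBasis K n) :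
    ∃ v ∈ matrices n, ∃ j i : Fin n, IsTip (monLT n) g (tipWord v j i) ∧
      coeff g (tipWord v j i) = 1 ∧
      ∀ w ∈ matrices n, ∀ j' i' c, coeff g c ≠ 0 → Divides (tipWord w j' i') c →
        tipWord w j' i' = tipWord v j i := by
  have hdiv : ∀ (w : Matrix (Fin n) (Fin n) (Gen n)) (j' i' : Fin n),
      ¬ Divides (tipWord w j' i') 1 := fun w j' i' h => by
    have := h.antisymm ⟨tipWord w j' i', 1, by simp⟩
    rw [tipWord_eq_relWord] at this
    exact relWord_ne_one _ _ _ this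
  have hdiv' : ∀ (v w : Matrix (Fin n) (Fin n) (Gen n)) (j' i' j i s : Fin n),
      Divides (tipWord w j' i') (relWord v j i s) → relWord v j i s = relWord w j' i' (lastIdx n) :=
    fun v w j' i' j i s h => by
      rw [← tipWord_eq_relWord]
      exact (h.eq_of_length_le le_rfl).symm
  obtain ⟨v, hv, rfl | ⟨j, i, hji, rfl⟩⟩ := hg
  · refine ⟨v, hv, _, _, (isTip_modRel K hv).1, (isTip_modRel K hv).2, ?_⟩
    intro w hw j' i' c hc hd
    rcases eq_of_coeff_modRel_ne_zero K hc with rfl | rfl | ⟨s, t, hs, ht, rfl⟩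
    · exact (hdiv _ _ _ hd).elim
    · exact hd.eq_of_length_le le_rfl
    · rcases relWord_eq_relWord_lastIdx hv hw (hdiv' _ _ _ _ _ _ _ hd) with h | ⟨h, -⟩
      exacts [(hs h).elim, (ht h).elim]
  · refine ⟨v, hv, _, _, (isTip_rel K hv j i).1, (isTip_rel K hv j i).2, ?_⟩
    intro w hw j' i' c hc hd
    rcases eq_of_coeff_rel_ne_zero K hc with rfl | ⟨s, rfl⟩
    · exact (hdiv _ _ _ hd).elim
    · have h := hdiv' _ _ _ _ _ _ _ hd
      rcases relWord_eq_relWord_lastIdx hv hw h with rfl | ⟨rfl, rfl⟩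
      · rw [tipWord_eq_relWord, tipWord_eq_relWord, h]
      · exact (hji rfl).elim

/-- Elements of the modified set are determined by their tips. -/
theorem eq_of_isTip_of_mem_redBasis {g g' : FreeAlgebra K (Gen n)} (hg : g ∈ redBasis K n)
    (hg' : g' ∈ redBasis K n) {b : FreeMonoid (Gen n)} (h : IsTip (monLT n) g b)
    (h' : IsTip (monLT n) g' b) : g = g' := by
  have hr := isMonomialOrder_monLT (n := n)
  have key : ∀ {v w : Matrix (Fin n) (Fin n) (Gen n)} {j i j' i' : Fin n}, v ∈ matrices n →
      w ∈ matrices n → tipWord v j i = tipWord w j' i' → (v = w ∧ j = j' ∧ i = i') ∨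
      (w = v.transpose ∧ j = lastIdx n ∧ j' = lastIdx n ∧ i = lastIdx n ∧ i' = lastIdx n) :=
    fun hv hw e => by
      rw [tipWord_eq_relWord, tipWord_eq_relWord, relWord_eq_iff] at e
      exact relWord_lastIdx_congr hv hw e.1 e.2
  obtain ⟨v, hv, rfl | ⟨j, i, hji, rfl⟩⟩ := hg <;>
    obtain ⟨w, hw, rfl | ⟨j', i', hji', rfl⟩⟩ := hg'
  · rcases key hv hw (((isTip_modRel K hv).1.unique hr h).trans
      (h'.unique hr (isTip_modRel K hw).1)) with ⟨rfl, -⟩ | ⟨rfl, -⟩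
    · rfl
    · exact (modRel_transpose K v).symm
  · rcases key hv hw (((isTip_modRel K hv).1.unique hr h).trans
      (h'.unique hr (isTip_rel K hw _ _).1)) with ⟨-, rfl, rfl⟩ | ⟨-, -, rfl, -, rfl⟩ <;>
    exact (hji' rfl).elim
  · rcases key hv hw (((isTip_rel K hv _ _).1.unique hr h).trans
      (h'.unique hr (isTip_modRel K hw).1)) with ⟨-, rfl, rfl⟩ | ⟨-, rfl, -, rfl, -⟩ <;>
    exact (hji rfl).elim
  · rcases key hv hw (((isTip_rel K hv _ _).1.unique hr h).trans
      (h'.unique hr (isTip_rel K hw _ _).1)) with ⟨rfl, rfl, rfl⟩ | ⟨-, rfl, -, rfl, -⟩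
    · rfl
    · exact (hji rfl).elim

theorem tips_redBasis : tips (monLT n) (redBasis K n) =
    {b | ∃ v ∈ matrices n, ∃ j i : Fin n, b = tipWord v j i} := by
  ext b
  constructor
  · rintro ⟨g, hg, hb⟩
    obtain ⟨v, hv, j, i, h, -⟩ := exists_tipWord_of_mem_redBasis K hg
    exact ⟨v, hv, j, i, hb.unique isMonomialOrder_monLT h⟩
  · rintro ⟨v, hv, j, i, rfl⟩
    by_cases hji : (j, i) = (lastIdx n, lastIdx n)
    · obtain ⟨rfl, rfl⟩ := Prod.ext_iff.1 hji
      exact ⟨_, ⟨v, hv, .inl rfl⟩, (isTip_modRel K hv).1⟩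
    · exact ⟨_, ⟨v, hv, .inr ⟨j, i, hji, rfl⟩⟩, (isTip_rel K hv j i).1⟩

theorem redBasis_subset : redBasis K n ⊆ {p | p ∈ relIdeal K n} := by
  rintro _ ⟨v, hv, rfl | ⟨j, i, -, rfl⟩⟩
  · exact modRel_mem K hv
  · exact TwoSidedIdeal.subset_span ⟨v, hv, j, i, rfl⟩

theorem isReducedGroebnerBasis_redBasis (hn : 2 ≤ n) :
    IsReducedGroebnerBasis (monLT n) (relIdeal K n) (redBasis K n) := by
  have hr := isMonomialOrder_monLT (n := n)
  have hred : ∀ g ∈ redBasis K n, ∀ g' ∈ redBasis K n, g ≠ g' → ∀ b c,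
      IsTip (monLT n) g b → coeff g' c ≠ 0 → ¬ Divides b c := by
    intro g hg g' hg' hne b c hb hc hd
    obtain ⟨v, hv, j, i, h, -⟩ := exists_tipWord_of_mem_redBasis K hg
    obtain ⟨w, hw, j', i', h', -, hdiv⟩ := exists_tipWord_of_mem_redBasis K hg'
    obtain rfl := hb.unique hr h
    exact hne (eq_of_isTip_of_mem_redBasis K hg hg' h (hdiv v hv j i c hc hd ▸ h'))
  refine ⟨⟨⟨redBasis_subset K, ?_⟩, ?_, ?_⟩, ?_, hred⟩
  · rw [tips_redBasis, ← tips_rels K]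
    exact (isGroebnerBasis_rels K hn).2
  · intro h0
    obtain ⟨v, hv, j, i, h, -⟩ := exists_tipWord_of_mem_redBasis K h0
    exact h.ne_zero rfl
  · intro g hg g' hg' hne b b' hb hb'
    exact hred g hg g' hg' hne b b' hb hb'.1
  · intro g hg b hb
    obtain ⟨v, hv, j, i, h, h1, -⟩ := exists_tipWord_of_mem_redBasis K hg
    rwa [hb.unique hr h]

end Relations

end UnitaryGB

open UnitaryGB
theorem mainTheorem2 (K : Type*) [Field K] (n : ℕ) [NeZero n] (hn : 2 ≤ n) :
    IsMonomialOrder (monLT n) ∧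
    (∀ v ∈ matrices n, ∀ j i : Fin n, IsTip (monLT n) (rel K v j i) (tipWord v j i)) ∧
    IsGroebnerBasis (monLT n) (relIdeal K n) (rels K n) ∧
    ¬ IsMinimalGroebnerBasis (monLT n) (relIdeal K n) (rels K n) ∧
    (∀ v ∈ matrices n,
      IsTip (monLT n) (modRel K v) (tipWord v (lastIdx n) (lastIdx n))) ∧
    IsReducedGroebnerBasis (monLT n) (relIdeal K n) (redBasis K n) ∧
    (∀ G : Set (FreeAlgebra K (Gen n)),
      IsReducedGroebnerBasis (monLT n) (relIdeal K n) G → G = redBasis K n) ∧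
    tips (monLT n) (redBasis K n) =
      {b | ∃ v ∈ matrices n, ∃ j i : Fin n, b = tipWord v j i} :=
  have hr := isMonomialOrder_monLT (n := n)
  have hred := isReducedGroebnerBasis_redBasis K hn
  ⟨hr, fun _ hv j i => (isTip_rel K hv j i).1, isGroebnerBasis_rels K hn,
    not_isMinimalGroebnerBasis_rels K hn, fun _ hv => (isTip_modRel K hv).1, hred,
    fun _ hG => (hG.subset hr hred).antisymm (hred.subset hr hG), tips_redBasis K⟩
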